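/- Let $k$ be a commutative ring of finite weak global dimension, i.e. there is a natural number bounding the flat dimensions of all $k$-modules. Let $G$ be a group such that every acyclic (unbounded) complex of projective $kG$-modules remains acyclic after applying $I\otimes_{kG}{-}$, for every injective right $kG$-module $I$ (such a $G$ is called an $\mathfrak{X}$-group). Call a module over a ring $R$ Gorenstein projective if it is isomorphic to the cokernel of a differential in an acyclic complex $P$ of projective $R$-modules such that the complex $\operatorname{Hom}_R(P,Q)$ is acyclic for every projective $R$-module $Q$. If $M$ and $N$ are Gorenstein projective $kG$-modules, then $M\otimes_k N$, with the diagonal action of $G$, is a Gorenstein projective $kG$-module. -/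

import Mathlib

open CategoryTheory
open scoped TensorProduct MonoidAlgebra

universe u v

noncomputable section

/-! ### The tensor product of a right module and a left module over an arbitrary ring

A right `R`-module is a module over `Rᵐᵒᵖ`. -/

section BalancedTensor

variable (R : Type u) [Ring R] (I : Type u) [AddCommGroup I] [Module Rᵐᵒᵖ I]

/-- The subgroup of `I ⊗[ℤ] M` generated by all `x r ⊗ m - x ⊗ r m`. -/
def balancedRelations (M : Type u) [AddCommGroup M] [Module R M] : AddSubgroup (I ⊗[ℤ] M) :=
  AddSubgroup.closure {t | ∃ (x : I) (r : R) (m : M),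
    t = (MulOpposite.op r • x) ⊗ₜ[ℤ] m - x ⊗ₜ[ℤ] (r • m)}

/-- The abelian group `I ⊗_R M`, for a right `R`-module `I` and a left `R`-module `M`. -/
abbrev BalancedTensor (M : Type u) [AddCommGroup M] [Module R M] : Type u :=
  (I ⊗[ℤ] M) ⧸ balancedRelations R I M

variable {M N : Type u} [AddCommGroup M] [Module R M] [AddCommGroup N] [Module R N]

theorem balancedRelations_le_comap (f : M →ₗ[R] N) :
    balancedRelations R I M ≤
      (balancedRelations R I N).comap
        (LinearMap.lTensor I f.toAddMonoidHom.toIntLinearMap).toAddMonoidHom := by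
  refine (AddSubgroup.closure_le _).2 ?_
  rintro _ ⟨x, r, m, rfl⟩
  refine AddSubgroup.subset_closure ⟨x, r, f m, ?_⟩
  simp

/-- The homomorphism `I ⊗_R f : I ⊗_R M → I ⊗_R N`, sending `x ⊗ m` to `x ⊗ f m`. -/
def balancedTensorMap (f : M →ₗ[R] N) : BalancedTensor R I M →+ BalancedTensor R I N :=
  QuotientAddGroup.map _ _ (LinearMap.lTensor I f.toAddMonoidHom.toIntLinearMap).toAddMonoidHom
    (balancedRelations_le_comap R I f)

variable {R I} in
theorem balancedTensor_hom_ext {A : Type u} [AddCommGroup A] {φ ψ : BalancedTensor R I M →+ A}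
    (h : ∀ (x : I) (m : M), φ (QuotientAddGroup.mk (x ⊗ₜ[ℤ] m)) =
      ψ (QuotientAddGroup.mk (x ⊗ₜ[ℤ] m))) : φ = ψ := by
  refine QuotientAddGroup.addMonoidHom_ext _ ?_
  ext t
  induction t with
  | zero => simp
  | tmul x m => exact h x m
  | add a b ha hb => rw [map_add, map_add, ha, hb]

theorem balancedTensorMap_tmul (f : M →ₗ[R] N) (x : I) (m : M) :
    balancedTensorMap R I f (QuotientAddGroup.mk (x ⊗ₜ[ℤ] m)) =
      QuotientAddGroup.mk (x ⊗ₜ[ℤ] f m) := rfl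

/-- The functor `I ⊗_R _` from left `R`-modules to abelian groups. -/
def balancedTensorFunctor : ModuleCat.{u} R ⥤ AddCommGrpCat.{u} where
  obj M := AddCommGrpCat.of (BalancedTensor R I M)
  map f := AddCommGrpCat.ofHom (balancedTensorMap R I f.hom)
  map_id M := by
    ext1
    exact balancedTensor_hom_ext fun _ _ => rfl
  map_comp f g := by
    ext1
    exact balancedTensor_hom_ext fun _ _ => rfl

instance : (balancedTensorFunctor R I).Additive where
  map_add {M N f g} := by
    ext1
    refine balancedTensor_hom_ext fun x m => ?_
    change QuotientAddGroup.mk (x ⊗ₜ[ℤ] (f.hom m + g.hom m)) =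
      (QuotientAddGroup.mk (x ⊗ₜ[ℤ] f.hom m) + QuotientAddGroup.mk (x ⊗ₜ[ℤ] g.hom m) :
        BalancedTensor R I N)
    rw [TensorProduct.tmul_add]
    rfl

end BalancedTensor

/-! ### Gorenstein projective modules -/

section Gorenstein

variable {R : Type u} [Ring R]

/-- `K` is an acyclic (unbounded) complex of projective `R`-modules. -/
structure IsAcyclicProjectiveComplex (K : ChainComplex (ModuleCat.{u} R) ℤ) : Prop where
  projective : ∀ n, Module.Projective R (K.X n)
  acyclic : K.Acyclic

/-- `K` is a totally acyclic complex of projective `R`-modules: it is an acyclic complex of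
projective modules and `Hom_R(K, Q)` is acyclic for every projective `R`-module `Q`. -/
structure IsTotallyAcyclicProjectiveComplex (K : ChainComplex (ModuleCat.{u} R) ℤ) : Prop
    extends IsAcyclicProjectiveComplex K where
  hom_acyclic : ∀ Q : ModuleCat.{u} R, Module.Projective R Q →
    (((preadditiveYoneda.obj Q).mapHomologicalComplex _).obj
      (HomologicalComplex.op K)).Acyclic

variable (R) in
/-- An `R`-module is Gorenstein projective if it is (isomorphic to) the cokernel of a differential
of a totally acyclic complex of projective `R`-modules. -/
def IsGorensteinProjective (M : Type u) [AddCommGroup M] [Module R M] : Prop :=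
  ∃ K : ChainComplex (ModuleCat.{u} R) ℤ, IsTotallyAcyclicProjectiveComplex K ∧
    ∃ n : ℤ, Nonempty ((K.X n ⧸ LinearMap.range (K.d (n + 1) n).hom) ≃ₗ[R] M)

end Gorenstein

/-! ### Weak global dimension of a commutative ring -/

/-- `M` has flat dimension at most `n`, i.e. there is an exact sequence
`0 → F_n → ⋯ → F_0 → M → 0` with all `F_i` flat. -/
def FlatDimensionLE (k : Type u) [CommRing k] :
    ℕ → ∀ (M : Type u) [AddCommGroup M] [Module k M], Prop
  | 0, M, _, _ => Module.Flat k M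
  | n + 1, M, _, _ => ∃ (F : Type u) (_ : AddCommGroup F) (_ : Module k F) (f : F →ₗ[k] M),
      Module.Flat k F ∧ Function.Surjective f ∧ FlatDimensionLE k n (LinearMap.ker f)

/-- `k` has finite weak global dimension: the flat dimensions of all `k`-modules are bounded by
one natural number. -/
def HasFiniteWeakGlobalDimension (k : Type u) [CommRing k] : Prop :=
  ∃ n : ℕ, ∀ (M : Type u) [AddCommGroup M] [Module k M], FlatDimensionLE k n M

/-! ### The class `𝔛` of groups -/

/-- `G` is an `𝔛`-group (with respect to the coefficient ring `k`): every acyclic complex of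
projective `k[G]`-modules remains acyclic after applying `I ⊗_{k[G]} _`, for any injective right
`k[G]`-module `I`. -/
def IsXGroup (k : Type u) [CommRing k] (G : Type v) [Group G] : Prop :=
  ∀ K : ChainComplex (ModuleCat.{max u v} k[G]) ℤ, IsAcyclicProjectiveComplex K →
    ∀ (I : Type (max u v)) [AddCommGroup I] [Module k[G]ᵐᵒᵖ I], Module.Injective k[G]ᵐᵒᵖ I →
      (((balancedTensorFunctor k[G] I).mapHomologicalComplex _).obj K).Acyclic

end

/-!
Let `K` be an acyclic complex of projective `k[G]`-modules with cokernel `M`. The complex `K ⊗ N`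
with diagonal action has cokernel `M ⊗ N`, and it suffices to show that it is totally acyclic.

* `N` is projective over `k` (`IsGorensteinProjective.projective_base`), because `k` has finite weak
  global dimension. Hence `K ⊗ N` is acyclic, and it consists of projective `k[G]`-modules, since
  `Hom(V ⊗ N, -) = Hom(V, Hom_k(N, -))` (`projective_diagonalTensor`).
* As `G` is an `𝔛`-group, `I ⊗ (K ⊗ N)` is acyclic for all injective right modules `I`, and this
  implies total acyclicity (`IsAcyclicProjectiveComplex.isTotallyAcyclic`).

Both points are instances of one principle. Let `K` be a complex of projective modules over any
ring and `X` a module such that `X⁺ ⊗ K` is acyclic, and remains so when `X⁺` is replaced by any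
power of it, where `X⁺` is the right module of characters of `X`. Then `Hom(K, X)` is acyclic. For
the second point `X` is free, so that powers of `X⁺` are injective. For the first one, `K` is an
acyclic complex of projective `k`-modules and tensoring it with any `k`-module keeps it acyclic by
dimension shifting; thus `Hom(K, X)` is acyclic for all `X`, and for `X` a cokernel in `K` this
splits off `X` from a projective module.

The principle is proved in two steps.

* Local solvability (`exists_local_of_characters`): for each finite `T ⊆ K_n` there is a finite
  `E ⊆ K_{n+1}` such that every `f : K_n → X` with `f ∘ d = 0` on `E` agrees on `T` with some
  `g ∘ d`. If no `E` worked, the characters detecting the failures for all `E` at once would form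
  one cycle with coefficients in a power of `X⁺`; it bounds a chain involving only finitely many
  elements of `K_{n+1}`, and these form an `E` that works.
* From local to global (`exists_coboundary_of_local`): the complex is folded into a single
  projective module with a differential. If it is countably generated, solutions on larger and
  larger finite sets are built which, after a correction by coboundaries, stabilise on each finite
  set. In general, Zorn's lemma extends partial solutions on subcomplexes `S` for which the quotient by `S` is still
  locally solvable; any such `S` can be enlarged by a countably generated piece containing a given
  element.
-/

noncomputable section

/-! ### Mittag-Leffler argument for differential modules -/

section DifferentialModule

/-- A countable set containing `b` and closed under a finitary operation `Ψ`. -/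
theorem exists_countable_closed {B : Type*} (Ψ : Finset B → Finset B) (b : B) :
    ∃ C : Set B, C.Countable ∧ b ∈ C ∧ ∀ T : Finset B, (T : Set B) ⊆ C → (Ψ T : Set B) ⊆ C := by
  classical
  let next : Set B → Set B := fun C => C ∪ ⋃ T ∈ {T : Finset B | (T : Set B) ⊆ C}, (Ψ T : Set B)
  let C : ℕ → Set B := fun n => next^[n] {b}
  have hC_succ : ∀ n, C (n + 1) = next (C n) := fun n => Function.iterate_succ_apply' next n {b}
  have hmono : Monotone C := monotone_nat_of_le_succ fun n => by
    rw [hC_succ]; exact Set.subset_union_left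
  have hcount : ∀ n, (C n).Countable := by
    intro n
    induction n with
    | zero => exact Set.countable_singleton b
    | succ n ih =>
      rw [hC_succ]
      refine ih.union (Set.Countable.biUnion ?_ fun T _ => (Ψ T).countable_toSet)
      have := Set.Countable.preimage_of_injOn
        (Set.countable_ofPred_finite_subset ih) (f := fun T : Finset B => (T : Set B))
        Finset.coe_injective.injOn
      exact this.mono fun T hT => by simpa using hT
  refine ⟨⋃ n, C n, Set.countable_iUnion hcount, Set.mem_iUnion.2 ⟨0, rfl⟩, fun T hT => ?_⟩
  obtain ⟨n, hn⟩ :=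
    Directed.exists_mem_subset_of_finset_subset_biUnion hmono.directed_le hT
  refine subset_trans ?_ (Set.subset_iUnion C (n + 1))
  rw [hC_succ]
  exact subset_trans (Set.subset_biUnion_of_mem (u := fun T : Finset B => (Ψ T : Set B)) hn)
    Set.subset_union_right

variable {R : Type*} [Ring R] {B X : Type*} [AddCommGroup X] [Module R X]

theorem Finsupp.linearMap_apply_eq_of_eq_on_support {f g : (B →₀ R) →ₗ[R] X} {x : B →₀ R}
    (h : ∀ b ∈ x.support, f (Finsupp.single b 1) = g (Finsupp.single b 1)) : f x = g x := by
  rw [← Finsupp.sum_single x, Finsupp.sum, map_sum, map_sum]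
  refine Finset.sum_congr rfl fun b hb => ?_
  rw [← mul_one (x b), ← smul_eq_mul, ← Finsupp.smul_single, map_smul, map_smul, h b hb]

/-- The set `S` of basis vectors spans a submodule stable under `φ`. -/
def IsStableSet (φ : (B →₀ R) →ₗ[R] (B →₀ R)) (S : Set B) : Prop :=
  ∀ b ∈ S, ((φ (Finsupp.single b 1)).support : Set B) ⊆ S

theorem IsStableSet.map_eq_zero {φ : (B →₀ R) →ₗ[R] (B →₀ R)} {S : Set B}
    (hS : IsStableSet φ S) {f : (B →₀ R) →ₗ[R] X} (hf : ∀ b ∈ S, f (Finsupp.single b 1) = 0)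
    {b : B} (hb : b ∈ S) : f (φ (Finsupp.single b 1)) = 0 := by
  rw [← LinearMap.zero_apply (σ₁₂ := RingHom.id R) (M := B →₀ R) (M₂ := X)
    (φ (Finsupp.single b 1))]
  exact Finsupp.linearMap_apply_eq_of_eq_on_support fun c hc => by simp [hf c (hS b hb hc)]

/-- The linear map that agrees with `f` on the basis vectors outside `S` and vanishes on `S`. -/
def killOn (S : Set B) (f : (B →₀ R) →ₗ[R] X) : (B →₀ R) →ₗ[R] X :=
  open Classical in
  Finsupp.linearCombination R fun b => if b ∈ S then 0 else f (Finsupp.single b 1)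

theorem killOn_of_mem {S : Set B} (f : (B →₀ R) →ₗ[R] X) {b : B} (hb : b ∈ S) :
    killOn S f (Finsupp.single b 1) = 0 := by
  simp [killOn, hb]

theorem killOn_of_notMem {S : Set B} (f : (B →₀ R) →ₗ[R] X) {b : B} (hb : b ∉ S) :
    killOn S f (Finsupp.single b 1) = f (Finsupp.single b 1) := by
  simp [killOn, hb]

/-- `E` is a test set for `T` relative to `S`: any `f` that vanishes on `S` and is a cocycle on
`E` is a coboundary on `T`, of a map that also vanishes on `S`. Only the maps `f` with
`f ∘ e = f`, i.e. those that factor through the idempotent `e`, are tested. -/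
def IsTestSet (X : Type*) [AddCommGroup X] [Module R X] (D e : (B →₀ R) →ₗ[R] (B →₀ R))
    (S : Set B) (T E : Finset B) : Prop :=
  ∀ f : (B →₀ R) →ₗ[R] X, f ∘ₗ e = f → (∀ b ∈ S, f (Finsupp.single b 1) = 0) →
    (∀ b ∈ E, f (D (Finsupp.single b 1)) = 0) →
    ∃ g : (B →₀ R) →ₗ[R] X, (∀ b ∈ S, g (Finsupp.single b 1) = 0) ∧
      ∀ b ∈ T, g (D (Finsupp.single b 1)) = f (Finsupp.single b 1)

variable {D e : (B →₀ R) →ₗ[R] (B →₀ R)}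

/-- The correction step: a map `g` vanishing on `S` whose coboundary vanishes on a test set of `U`
can be changed, without changing its coboundary, so that it vanishes on `U` as well. -/
theorem IsTestSet.exists_correction (hDD : D ∘ₗ D = 0) (hee : e ∘ₗ e = e) (heD : e ∘ₗ D = D)
    {S : Set B} (hSD : IsStableSet D S) (hSe : IsStableSet e S) {U E : Finset B}
    (hE : IsTestSet X D e S U E) (g : (B →₀ R) →ₗ[R] X)
    (hgS : ∀ b ∈ S, g (Finsupp.single b 1) = 0)
    (hgE : ∀ b ∈ E, g (D (Finsupp.single b 1)) = 0) :
    ∃ h : (B →₀ R) →ₗ[R] X, (∀ b ∈ S, h (Finsupp.single b 1) = 0) ∧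
      (∀ b ∈ U, h (Finsupp.single b 1) = 0) ∧ h ∘ₗ D = g ∘ₗ D := by
  obtain ⟨l, hlS, hlU⟩ := hE (g ∘ₗ e) (by rw [LinearMap.comp_assoc, hee])
    (fun b hb => hSe.map_eq_zero hgS hb)
    (fun b hb => by
      have : e (D (Finsupp.single b 1)) = D (Finsupp.single b 1) := LinearMap.congr_fun heD _
      rw [LinearMap.comp_apply, this, hgE b hb])
  refine ⟨g ∘ₗ e - l ∘ₗ D, fun b hb => ?_, fun b hb => ?_, ?_⟩
  · simp [hSe.map_eq_zero hgS hb, hSD.map_eq_zero hlS hb]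
  · simp [hlU b hb]
  · rw [LinearMap.sub_comp, LinearMap.comp_assoc, LinearMap.comp_assoc, heD, hDD,
      LinearMap.comp_zero, sub_zero]

/-- Every finite set has a test set relative to `S`. This says that the quotient of the complex by
the span of `S` is locally acyclic with respect to `Hom(-, X)`. -/
def HasTestSets (X : Type*) [AddCommGroup X] [Module R X] (D e : (B →₀ R) →ₗ[R] (B →₀ R))
    (S : Set B) : Prop :=
  ∀ T : Finset B, ∃ E : Finset B, IsTestSet X D e S T E

/-- Test sets survive when `S` is enlarged by a set `C` that contains the test sets of its own
finite subsets. A solution `g` on `T` vanishing on `S` is corrected so that it also vanishes on the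
finitely many elements `U` of `C` that its values on `D(T)` involve, then reset to zero on `C`. -/
theorem HasTestSets.union (hDD : D ∘ₗ D = 0) (hee : e ∘ₗ e = e) (heD : e ∘ₗ D = D)
    {S C : Set B} (hSD : IsStableSet D S) (hSe : IsStableSet e S)
    (hS : HasTestSets X D e S)
    (hC : ∀ U : Finset B, (U : Set B) ⊆ C → ∃ E : Finset B, (E : Set B) ⊆ C ∧
      IsTestSet X D e S U E) :
    HasTestSets X D e (S ∪ C) := by
  classical
  intro T
  let U : Finset B := (T.biUnion fun t => (D (Finsupp.single t 1)).support).filter (· ∈ C)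
  obtain ⟨E', hE'C, hE'⟩ := hC U fun b hb => (Finset.mem_filter.1 hb).2
  obtain ⟨E, hE⟩ := hS (T ∪ E')
  refine ⟨E, fun f hf hfSC hfE => ?_⟩
  obtain ⟨g, hgS, hg⟩ := hE f hf (fun b hb => hfSC b (Or.inl hb)) hfE
  obtain ⟨h, hhS, hhU, hhD⟩ := hE'.exists_correction hDD hee heD hSD hSe g hgS fun b hb => by
    rw [hg b (Finset.mem_union_right _ hb), hfSC b (Or.inr (hE'C hb))]
  refine ⟨killOn (S ∪ C) h, fun b hb => killOn_of_mem h hb, fun b hb => ?_⟩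
  rw [← hg b (Finset.mem_union_left _ hb), ← LinearMap.comp_apply g D, ← hhD,
    LinearMap.comp_apply]
  refine Finsupp.linearMap_apply_eq_of_eq_on_support fun c hc => ?_
  by_cases hcS : c ∈ S ∪ C
  · rw [killOn_of_mem h hcS]
    rcases hcS with hcS | hcC
    · exact (hhS c hcS).symm
    · exact (hhU c (Finset.mem_filter.2 ⟨Finset.mem_biUnion.2 ⟨b, hb, hc⟩, hcC⟩)).symm
  · rw [killOn_of_notMem h hcS]

/-- Test sets survive directed unions, since `D(T)` involves only finitely many basis vectors: a
test set relative to a member of `c` containing those of them in `⋃₀ c` still works. -/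
theorem HasTestSets.sUnion {c : Set (Set B)} (hc : c.Nonempty) (hdir : DirectedOn (· ⊆ ·) c)
    (h : ∀ S ∈ c, HasTestSets X D e S) : HasTestSets X D e (⋃₀ c) := by
  classical
  intro T
  let U : Finset B := (T.biUnion fun t => (D (Finsupp.single t 1)).support).filter (· ∈ ⋃₀ c)
  obtain ⟨S, hSc, hUS⟩ := hdir.exists_mem_subset_of_finite_of_subset_sUnion hc
    U.finite_toSet fun b hb => (Finset.mem_filter.1 hb).2
  obtain ⟨E, hE⟩ := h S hSc T
  refine ⟨E, fun f hf hfS hfE => ?_⟩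
  obtain ⟨g, hgS, hg⟩ := hE f hf (fun b hb => hfS b (Set.mem_sUnion_of_mem hb hSc)) hfE
  refine ⟨killOn (⋃₀ c) g, fun b hb => killOn_of_mem g hb, fun b hb => ?_⟩
  rw [← hg b hb]
  refine Finsupp.linearMap_apply_eq_of_eq_on_support fun a ha => ?_
  by_cases haS : a ∈ ⋃₀ c
  · rw [killOn_of_mem g haS]
    exact (hgS a (hUS (Finset.mem_filter.2 ⟨Finset.mem_biUnion.2 ⟨b, hb, ha⟩, haS⟩))).symm
  · rw [killOn_of_notMem g haS]

/-- A Mittag-Leffler argument: over a countable set `C` of basis vectors, a cocycle that vanishes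
on `S` is a coboundary. -/
theorem HasTestSets.exists_coboundary_on_countable (hDD : D ∘ₗ D = 0) (hee : e ∘ₗ e = e)
    (heD : e ∘ₗ D = D) (hDe : D ∘ₗ e = D) {S C : Set B} (hSD : IsStableSet D S)
    (hSe : IsStableSet e S) (hS : HasTestSets X D e S) (hC : C.Countable) (hCne : C.Nonempty)
    (hCD : IsStableSet D C) (f : (B →₀ R) →ₗ[R] X) (hf : f ∘ₗ e = f) (hfD : f ∘ₗ D = 0)
    (hfS : ∀ b ∈ S, f (Finsupp.single b 1) = 0) :
    ∃ g : (B →₀ R) →ₗ[R] X, (∀ b ∈ S, g (Finsupp.single b 1) = 0) ∧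
      ∀ b ∈ S ∪ C, g (D (Finsupp.single b 1)) = f (Finsupp.single b 1) := by
  classical
  obtain ⟨c, rfl⟩ := hC.exists_eq_range hCne
  choose E hE using hS
  -- `U i` exhausts `C`, and `T i` contains both `U i` and a test set of `U i`.
  let U : ℕ → Finset B := fun i => (Finset.range i).image c
  let T : ℕ → Finset B := fun i => U i ∪ E (U i)
  let P : ℕ → ((B →₀ R) →ₗ[R] X) → Prop := fun i g =>
    (∀ b ∈ S, g (Finsupp.single b 1) = 0) ∧
      ∀ b ∈ T i, g (D (Finsupp.single b 1)) = f (Finsupp.single b 1)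
  have step : ∀ i (g : {g // P i g}), ∃ g' : {g // P (i + 1) g},
      ∀ b ∈ U i, g'.1 (Finsupp.single b 1) = g.1 (Finsupp.single b 1) := by
    rintro i ⟨g, hgS, hgT⟩
    -- The error `f - g ∘ D` vanishes on `T i`, so that it is the coboundary on `T (i + 1)` of a map
    -- that can be corrected to vanish on `U i`.
    obtain ⟨g₁, hg₁S, hg₁⟩ := hE (T i ∪ T (i + 1)) (f - g ∘ₗ D)
      (by rw [LinearMap.sub_comp, hf, LinearMap.comp_assoc, hDe])
      (fun b hb => by simp [hfS b hb, hSD.map_eq_zero hgS hb])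
      (fun b _ => by
        have h1 : f (D (Finsupp.single b 1)) = 0 := LinearMap.congr_fun hfD _
        have h2 : D (D (Finsupp.single b 1)) = 0 := LinearMap.congr_fun hDD _
        simp [h1, h2])
    obtain ⟨h, hhS, hhU, hhD⟩ := (hE (U i)).exists_correction hDD hee heD hSD hSe g₁ hg₁S
      fun b hb => by
        have hbT : b ∈ T i := Finset.mem_union_right _ hb
        rw [hg₁ b (Finset.mem_union_left _ hbT)]
        simp [hgT b hbT]
    refine ⟨⟨g + h, fun b hb => ?_, fun b hb => ?_⟩, fun b hb => ?_⟩
    · simp [hgS b hb, hhS b hb]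
    · have h3 : h (D (Finsupp.single b 1)) = g₁ (D (Finsupp.single b 1)) :=
        LinearMap.congr_fun hhD _
      rw [LinearMap.add_apply, h3, hg₁ b (Finset.mem_union_right _ hb)]
      simp
    · simp [hhU b hb]
  choose next hnext using step
  have start : ∃ g, P 0 g := hE (T 0) f hf hfS fun b _ => LinearMap.congr_fun hfD _
  let g : ∀ i, {g // P i g} := fun i => Nat.rec ⟨start.choose, start.choose_spec⟩ next i
  have hg_succ : ∀ i, ∀ b ∈ U i, (g (i + 1)).1 (Finsupp.single b 1) =
      (g i).1 (Finsupp.single b 1) := fun i b hb => hnext i (g i) b hb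
  have hU : ∀ {i j}, i ≤ j → U i ⊆ U j := fun hij =>
    Finset.image_subset_image (Finset.range_mono hij)
  have hg_eq : ∀ {i j}, i ≤ j → ∀ b ∈ U i, (g j).1 (Finsupp.single b 1) =
      (g i).1 (Finsupp.single b 1) := by
    intro i j hij b hb
    induction j, hij using Nat.le_induction with
    | base => rfl
    | succ j hij ih => rw [hg_succ j b (hU hij hb), ih]
  let g' : (B →₀ R) →ₗ[R] X := Finsupp.linearCombination R fun b =>
    if h : ∃ i, b ∈ U i then (g (Nat.find h)).1 (Finsupp.single b 1) else 0
  have hg' : ∀ i, ∀ b ∈ U i, g' (Finsupp.single b 1) = (g i).1 (Finsupp.single b 1) := by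
    intro i b hb
    have h : ∃ i, b ∈ U i := ⟨i, hb⟩
    simp only [g', Finsupp.linearCombination_single, one_smul, dif_pos h]
    exact (hg_eq (Nat.find_min' h hb) b (Nat.find_spec h)).symm
  have hg'S : ∀ b ∈ S, g' (Finsupp.single b 1) = 0 := by
    intro b hb
    by_cases h : ∃ i, b ∈ U i
    · obtain ⟨i, hi⟩ := h
      rw [hg' i b hi, (g i).2.1 b hb]
    · simp only [g', Finsupp.linearCombination_single, one_smul, dif_neg h]
  refine ⟨g', hg'S, fun b hb => ?_⟩
  rcases hb with hb | hb
  · rw [hfS b hb, hSD.map_eq_zero hg'S hb]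
  · have hsub : ((insert b (D (Finsupp.single b 1)).support : Finset B) : Set B) ⊆
        ⋃ i, (U i : Set B) := by
      intro a ha
      have haC : a ∈ Set.range c := by
        rcases Finset.mem_insert.1 ha with rfl | ha
        · exact hb
        · exact hCD b hb ha
      obtain ⟨n, rfl⟩ := haC
      exact Set.mem_iUnion.2 ⟨n + 1, Finset.mem_coe.2 (Finset.mem_image_of_mem c (by simp))⟩
    have hmono : Monotone fun i => (U i : Set B) := fun i j hij => Finset.coe_subset.2 (hU hij)
    obtain ⟨i, hi⟩ := hmono.directed_le.exists_mem_subset_of_finset_subset_biUnion hsub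
    rw [← (g i).2.2 b (Finset.mem_union_left _ (hi (Finset.mem_insert_self _ _)))]
    exact Finsupp.linearMap_apply_eq_of_eq_on_support fun a ha =>
      hg' i a (hi (Finset.mem_insert_of_mem ha))

/-- Over a free module, local solvability of `g ∘ D = f` implies solvability. The idempotent `e`
cuts out a direct summand on which the differential `D` lives. -/
theorem HasTestSets.exists_coboundary (hDD : D ∘ₗ D = 0) (hee : e ∘ₗ e = e)
    (heD : e ∘ₗ D = D) (hDe : D ∘ₗ e = D) (h : HasTestSets X D e ∅)
    (f : (B →₀ R) →ₗ[R] X) (hf : f ∘ₗ e = f) (hfD : f ∘ₗ D = 0) :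
    ∃ g : (B →₀ R) →ₗ[R] X, g ∘ₗ D = f := by
  classical
  -- Partial solutions on stable sets `S` relative to which test sets still exist.
  let Sol : Type _ := {p : Set B × ((B →₀ R) →ₗ[R] X) // IsStableSet D p.1 ∧ IsStableSet e p.1 ∧
    HasTestSets X D e p.1 ∧ ∀ b ∈ p.1, p.2 (D (Finsupp.single b 1)) = f (Finsupp.single b 1)}
  let r : Sol → Sol → Prop := fun p q => p.1.1 ⊆ q.1.1 ∧
    ∀ b ∈ p.1.1, q.1.2 (Finsupp.single b 1) = p.1.2 (Finsupp.single b 1)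
  have hrefl : ∀ p, r p p := fun p => ⟨subset_rfl, fun _ _ => rfl⟩
  obtain ⟨⟨⟨S, g⟩, hSD, hSe, hS, hg⟩, hmax⟩ : ∃ m, ∀ a, r m a → r a m := by
    refine exists_maximal_of_chains_bounded (fun c hc => ?_) fun {p q s} hpq hqs =>
      ⟨hpq.1.trans hqs.1, fun b hb => (hqs.2 b (hpq.1 hb)).trans (hpq.2 b hb)⟩
    rcases c.eq_empty_or_nonempty with rfl | hne
    · exact ⟨⟨(∅, 0), by simp [IsStableSet], by simp [IsStableSet], h, by simp⟩, by simp⟩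
    have htotal : ∀ p ∈ c, ∀ q ∈ c, r p q ∨ r q p := fun p hp q hq => by
      by_cases hpq : p = q
      · exact Or.inl (hpq ▸ hrefl p)
      · exact hc hp hq hpq
    let S : Set B := ⋃₀ ((fun p : Sol => p.1.1) '' c)
    have hmem : ∀ {b}, b ∈ S ↔ ∃ p ∈ c, b ∈ p.1.1 := by simp [S]
    let g : (B →₀ R) →ₗ[R] X := Finsupp.linearCombination R fun b =>
      if hb : ∃ p ∈ c, b ∈ p.1.1 then hb.choose.1.2 (Finsupp.single b 1) else 0
    have hg : ∀ p ∈ c, ∀ b ∈ p.1.1, g (Finsupp.single b 1) = p.1.2 (Finsupp.single b 1) := by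
      intro p hp b hb
      have hb' : ∃ p ∈ c, b ∈ p.1.1 := ⟨p, hp, hb⟩
      simp only [g, Finsupp.linearCombination_single, one_smul, dif_pos hb']
      rcases htotal _ hb'.choose_spec.1 p hp with h' | h'
      · exact (h'.2 b hb'.choose_spec.2).symm
      · exact h'.2 b hb
    refine ⟨⟨(S, g), ?_, ?_, ?_, ?_⟩, fun p hp => ⟨fun b hb => hmem.2 ⟨p, hp, hb⟩, hg p hp⟩⟩
    · intro b hb
      obtain ⟨p, hp, hbp⟩ := hmem.1 hb
      exact (p.2.1 b hbp).trans fun a ha => hmem.2 ⟨p, hp, ha⟩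
    · intro b hb
      obtain ⟨p, hp, hbp⟩ := hmem.1 hb
      exact (p.2.2.1 b hbp).trans fun a ha => hmem.2 ⟨p, hp, ha⟩
    · refine HasTestSets.sUnion (hne.image _) ?_ ?_
      · rintro _ ⟨p, hp, rfl⟩ _ ⟨q, hq, rfl⟩
        rcases htotal p hp q hq with h' | h'
        · exact ⟨_, ⟨q, hq, rfl⟩, h'.1, subset_rfl⟩
        · exact ⟨_, ⟨p, hp, rfl⟩, subset_rfl, h'.1⟩
      · rintro _ ⟨p, hp, rfl⟩
        exact p.2.2.2.1
    · intro b hb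
      obtain ⟨p, hp, hbp⟩ := hmem.1 hb
      rw [← p.2.2.2.2 b hbp]
      exact Finsupp.linearMap_apply_eq_of_eq_on_support fun a ha => hg p hp a (p.2.1 b hbp ha)
  have hSuniv : ∀ b, b ∈ S := by
    by_contra! hb
    obtain ⟨b, hb⟩ := hb
    -- `S` is enlarged by a countable set `C` closed under `D`, `e` and the choice `E` of test sets.
    choose E hE using id hS
    obtain ⟨C, hC, hbC, hclosed⟩ := exists_countable_closed (fun T : Finset B =>
      E T ∪ T.biUnion fun t => (D (Finsupp.single t 1)).support ∪ (e (Finsupp.single t 1)).support)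
      b
    have hclosed' : ∀ a ∈ C, ∀ a' ∈ (D (Finsupp.single a 1)).support ∪
        (e (Finsupp.single a 1)).support, a' ∈ C := fun a ha a' ha' =>
      hclosed {a} (by simpa using ha) (Finset.mem_union_right _ (by simpa using ha'))
    have hCD : IsStableSet D C := fun a ha a' ha' =>
      hclosed' a ha a' (Finset.mem_union_left _ ha')
    have hCe : IsStableSet e C := fun a ha a' ha' =>
      hclosed' a ha a' (Finset.mem_union_right _ ha')
    obtain ⟨h', hh'S, hh'⟩ := HasTestSets.exists_coboundary_on_countable hDD hee heD hDe hSD hSe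
      (fun T => ⟨E T, hE T⟩) hC ⟨b, hbC⟩ hCD (f - g ∘ₗ D)
      (by rw [LinearMap.sub_comp, hf, LinearMap.comp_assoc, hDe])
      (by rw [LinearMap.sub_comp, hfD, LinearMap.comp_assoc, hDD, LinearMap.comp_zero, sub_zero])
      (fun a ha => by simp [hg a ha])
    have hunion : ∀ {φ : (B →₀ R) →ₗ[R] (B →₀ R)}, IsStableSet φ S → IsStableSet φ C →
        IsStableSet φ (S ∪ C) := fun hφS hφC a ha => by
      rcases ha with ha | ha
      · exact (hφS a ha).trans Set.subset_union_left
      · exact (hφC a ha).trans Set.subset_union_right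
    have := hmax ⟨(S ∪ C, g + h'), hunion hSD hCD, hunion hSe hCe,
      HasTestSets.union hDD hee heD hSD hSe (fun T => ⟨E T, hE T⟩) fun U hU =>
        ⟨E U, fun a ha => hclosed U hU (Finset.mem_union_left _ ha), hE U⟩,
      fun a ha => by simp [hh' a ha]⟩ ⟨Set.subset_union_left, fun a ha => by simp [hh'S a ha]⟩
    exact hb (this.1 (Or.inr hbC))
  exact ⟨g, Finsupp.lhom_ext' fun b => LinearMap.ext_ring (by simpa using hg b (hSuniv b))⟩

/-- Over a projective module with a differential `d`, local solvability of `g ∘ d = f` implies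
solvability. -/
theorem exists_coboundary_of_local {F : Type*} [AddCommGroup F] [Module R F]
    [Module.Projective R F] (d : F →ₗ[R] F) (hd : d ∘ₗ d = 0)
    (hloc : ∀ T : Finset F, ∃ E : Finset F, ∀ f : F →ₗ[R] X, (∀ x ∈ E, f (d x) = 0) →
      ∃ g : F →ₗ[R] X, ∀ x ∈ T, g (d x) = f x)
    (f : F →ₗ[R] X) (hf : f ∘ₗ d = 0) : ∃ g : F →ₗ[R] X, g ∘ₗ d = f := by
  obtain ⟨s, hs⟩ := Module.projective_def'.1 (inferInstance : Module.Projective R F)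
  -- `F` is a direct summand of the free module on its elements; `d` is extended by zero to it.
  set p : (F →₀ R) →ₗ[R] F := Finsupp.linearCombination R id
  have hp : ∀ x, p (s x) = x := fun x => LinearMap.congr_fun hs x
  have hp1 : ∀ x, p (Finsupp.single x 1) = x := fun x => by simp [p]
  have hd' : ∀ x, d (d x) = 0 := fun x => LinearMap.congr_fun hd x
  have key : HasTestSets X (s ∘ₗ d ∘ₗ p) (s ∘ₗ p) ∅ := by
    intro T
    obtain ⟨E, hE⟩ := hloc T
    refine ⟨E, fun f hf _ hfE => ?_⟩
    obtain ⟨g, hg⟩ := hE (f ∘ₗ s) fun x hx => by simpa [hp1] using hfE x hx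
    refine ⟨g ∘ₗ p, by simp, fun b hb => ?_⟩
    have h1 : f (s (p (Finsupp.single b 1))) = f (Finsupp.single b 1) :=
      LinearMap.congr_fun hf _
    rw [← h1]
    simpa [hp, hp1] using hg b hb
  obtain ⟨g, hg⟩ := key.exists_coboundary (by ext; simp [hp, hd']) (by ext; simp [hp])
    (by ext; simp [hp]) (by ext; simp [hp]) (f ∘ₗ p) (by ext; simp [hp])
    (by
      refine LinearMap.ext fun x => ?_
      simpa [hp] using LinearMap.congr_fun hf (p x))
  refine ⟨g ∘ₗ s, LinearMap.ext fun x => ?_⟩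
  simpa [hp] using LinearMap.congr_fun hg (s x)

end DifferentialModule

/-! ### From differential modules to complexes -/

section GradedComplex

open DirectSum

variable {R : Type*} [Ring R] {V : ℤ → Type*} [∀ n, AddCommGroup (V n)] [∀ n, Module R (V n)]
  {X : Type*} [AddCommGroup X] [Module R X]

/-- For a complex of projective modules, local solvability of `g ∘ d = f` in each degree implies
solvability. -/
theorem exists_coboundary_of_local_of_complex [∀ n, Module.Projective R (V n)]
    (d : ∀ i j, V i →ₗ[R] V j) (hd : ∀ i j k x, d j k (d i j x) = 0)
    (hloc : ∀ n (T : Finset (V n)), ∃ E : Finset (V (n + 1)), ∀ f : V n →ₗ[R] X,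
      (∀ x ∈ E, f (d (n + 1) n x) = 0) →
        ∃ g : V (n - 1) →ₗ[R] X, ∀ x ∈ T, g (d n (n - 1) x) = f x)
    (n : ℤ) (f : V n →ₗ[R] X) (hf : ∀ x, f (d (n + 1) n x) = 0) :
    ∃ g : V (n - 1) →ₗ[R] X, ∀ x, g (d n (n - 1) x) = f x := by
  classical
  -- The total differential on the direct sum.
  let D : (⨁ n, V n) →ₗ[R] (⨁ n, V n) :=
    DirectSum.toModule R ℤ _ fun n => DirectSum.lof R ℤ V (n - 1) ∘ₗ d n (n - 1)
  have hD : ∀ i j, j = i - 1 → ∀ x, D (DirectSum.lof R ℤ V i x) =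
      DirectSum.lof R ℤ V j (d i j x) := by
    rintro i j rfl x
    simp [D]
  have hDD : D ∘ₗ D = 0 := by
    refine DirectSum.linearMap_ext R fun i => LinearMap.ext fun x => ?_
    simp [hD i _ rfl, hD _ _ rfl, hd]
  have key : ∀ T : Finset (⨁ n, V n), ∃ E : Finset (⨁ n, V n), ∀ f : (⨁ n, V n) →ₗ[R] X,
      (∀ x ∈ E, f (D x) = 0) → ∃ g : (⨁ n, V n) →ₗ[R] X, ∀ x ∈ T, g (D x) = f x := by
    intro T
    let N : Finset ℤ := T.biUnion fun x => DFinsupp.support x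
    let S : ∀ n, Finset (V n) := fun n => T.image fun x => x n
    choose E hE using hloc
    refine ⟨N.biUnion fun n => (E n (S n)).image (DirectSum.lof R ℤ V (n + 1)),
      fun f hf => ?_⟩
    have hg : ∀ m, ∃ g : V m →ₗ[R] X, ∀ n, m = n - 1 → n ∈ N →
        ∀ x ∈ S n, g (d n m x) = f (DirectSum.lof R ℤ V n x) := by
      intro m
      by_cases hm : m + 1 ∈ N
      · obtain ⟨n, rfl⟩ : ∃ n, m = n - 1 := ⟨m + 1, by ring⟩
        rw [sub_add_cancel] at hm
        obtain ⟨g, hg⟩ := hE n (S n) (f ∘ₗ DirectSum.lof R ℤ V n) fun x hx => by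
          rw [LinearMap.comp_apply, ← hD (n + 1) n (by ring)]
          exact hf _ (Finset.mem_biUnion.2 ⟨n, hm, Finset.mem_image_of_mem _ hx⟩)
        refine ⟨g, fun n' hn' _ x hx => ?_⟩
        obtain rfl : n = n' := by linarith
        exact hg x hx
      · refine ⟨0, fun n hn hnN => absurd ?_ hm⟩
        rwa [hn, sub_add_cancel]
    choose g hg using hg
    refine ⟨DirectSum.toModule R ℤ X g, fun x hx => ?_⟩
    rw [← DirectSum.sum_support_of x]
    simp only [map_sum]
    refine Finset.sum_congr rfl fun i hi => ?_
    have := hg (i - 1) i rfl (Finset.mem_biUnion.2 ⟨x, hx, hi⟩) (x i)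
      (Finset.mem_image_of_mem _ hx)
    rw [← DirectSum.lof_eq_of R, hD i _ rfl, DirectSum.toModule_lof, this]
  obtain ⟨g, hg⟩ := exists_coboundary_of_local D hDD key
    (f ∘ₗ DirectSum.component R ℤ V n) (by
      refine DirectSum.linearMap_ext R fun i => LinearMap.ext fun x => ?_
      simp only [LinearMap.comp_apply, hD i _ rfl, LinearMap.zero_apply]
      by_cases h : i - 1 = n
      · obtain rfl : i = n + 1 := by linarith
        have := hf x
        revert this
        generalize hm : n + 1 - 1 = m
        obtain rfl : n = m := by linarith
        intro this
        rw [DirectSum.component.lof_self, this]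
      · rw [DirectSum.component.of, dif_neg h, map_zero])
  refine ⟨g ∘ₗ DirectSum.lof R ℤ V (n - 1), fun x => ?_⟩
  have := LinearMap.congr_fun hg (DirectSum.lof R ℤ V n x)
  rwa [LinearMap.comp_apply, hD n _ rfl, LinearMap.comp_apply, DirectSum.component.lof_self]
    at this

end GradedComplex

/-! ### Local solvability via characters -/

section Characters

variable {R : Type*} [Ring R] {V₀ V₁ V₂ X : Type*} [AddCommGroup V₀] [Module R V₀]
  [AddCommGroup V₁] [Module R V₁] [AddCommGroup V₂] [Module R V₂] [AddCommGroup X] [Module R X]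

/-- Local solvability follows from a uniform statement about characters: the obstructions to
solving `g ∘ d₀ = f` on `T` are families of characters `χ` killing all `g ∘ d₀`, and one such
family, indexed by all candidate finite sets `E`, is enough to detect that no `E` works. -/
theorem exists_local_of_characters (d₁ : V₂ →ₗ[R] V₁) (d₀ : V₁ →ₗ[R] V₀) (T : Finset V₁)
    (H : ∀ χ : T → Finset V₂ → CharacterModule X,
      (∀ (E : Finset V₂) (g : V₀ →ₗ[R] X), ∑ t, χ t E (g (d₀ t)) = 0) →
        ∃ J : Finset V₂, ∀ (E : Finset V₂) (f : V₁ →ₗ[R] X), (∀ x ∈ J, f (d₁ x) = 0) →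
          ∑ t, χ t E (f t) = 0) :
    ∃ E : Finset V₂, ∀ f : V₁ →ₗ[R] X, (∀ x ∈ E, f (d₁ x) = 0) →
      ∃ g : V₀ →ₗ[R] X, ∀ x ∈ T, g (d₀ x) = f x := by
  classical
  by_contra! hcon
  choose f hf hfne using hcon
  -- The restrictions to `T` of the coboundaries.
  let cob : (V₀ →ₗ[R] X) →+ (T → X) :=
    { toFun g t := g (d₀ t)
      map_zero' := rfl
      map_add' _ _ := rfl }
  have hne : ∀ E, (QuotientAddGroup.mk (fun t : T => f E t) : (T → X) ⧸ cob.range) ≠ 0 := by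
    intro E h
    obtain ⟨g, hg⟩ := (QuotientAddGroup.eq_zero_iff _).1 h
    obtain ⟨x, hx, hgx⟩ := hfne E g
    exact hgx (congr_fun hg ⟨x, hx⟩)
  choose ψ hψ using fun E => CharacterModule.exists_character_apply_ne_zero_of_ne_zero (hne E)
  let χ : T → Finset V₂ → CharacterModule X := fun t E =>
    AddMonoidHom.comp (ψ E) <|
      ((QuotientAddGroup.mk' cob.range).comp (AddMonoidHom.single (fun _ : T => X) t))
  have hχ : ∀ E (w : T → X), ∑ t, χ t E (w t) = ψ E (QuotientAddGroup.mk w) := by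
    intro E w
    conv_rhs => rw [← Finset.univ_sum_single w]
    change _ = ψ E (QuotientAddGroup.mk' cob.range _)
    rw [map_sum, map_sum]
    rfl
  obtain ⟨J, hJ⟩ := H χ fun E g => by
    have h0 : (QuotientAddGroup.mk (fun t : T => g (d₀ t)) : (T → X) ⧸ cob.range) = 0 :=
      (QuotientAddGroup.eq_zero_iff _).2 (AddMonoidHom.mem_range.2 ⟨g, rfl⟩)
    rw [hχ E fun t => g (d₀ t), h0, map_zero]
  exact hψ J ((hχ J fun t => f J t).symm.trans (hJ J (f J) (hf J)))

/-- In a tensor product with a projective module, an element is zero as soon as it is annihilated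
by all functionals. Here `β` is any balanced pairing on `Λ → CharacterModule X` and `V₀`, for the
right action of `R` on characters of `X`. -/
theorem sum_balanced_eq_zero [Module.Projective R V₀] {Λ A τ : Type*} [AddCommGroup A] [Fintype τ]
    (β : (Λ → CharacterModule X) →+ V₀ →+ A)
    (hβ : ∀ (r : R) (x x' : Λ → CharacterModule X) (v : V₀),
      (∀ E y, x' E y = x E (r • y)) → β x (r • v) = β x' v)
    (x : τ → Λ → CharacterModule X) (v : τ → V₀)
    (h : ∀ E (g : V₀ →ₗ[R] X), ∑ t, x t E (g (v t)) = 0) : ∑ t, β (x t) (v t) = 0 := by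
  classical
  obtain ⟨s, hs⟩ := Module.projective_def'.1 (inferInstance : Module.Projective R V₀)
  let W : Finset V₀ := Finset.univ.biUnion fun t => (s (v t)).support
  let act : R → (Λ → CharacterModule X) → (Λ → CharacterModule X) := fun r x E =>
    AddMonoidHom.comp (x E) (DistribSMul.toAddMonoidHom X r)
  have hv : ∀ t, v t = ∑ b ∈ W, s (v t) b • b := by
    intro t
    conv_lhs => rw [← LinearMap.id_apply (R := R) (v t), ← hs]
    rw [LinearMap.comp_apply, Finsupp.linearCombination_apply, Finsupp.sum_of_support_subset]
    · rfl
    · exact Finset.subset_biUnion_of_mem (fun t => (s (v t)).support) (Finset.mem_univ t)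
    · simp
  have hβ' : ∀ t, β (x t) (v t) = ∑ b ∈ W, β (act (s (v t) b) (x t)) b := by
    intro t
    conv_lhs => rw [hv t]
    rw [map_sum]
    exact Finset.sum_congr rfl fun b _ => hβ _ _ _ _ fun E y => rfl
  simp only [hβ']
  rw [Finset.sum_comm]
  refine Finset.sum_eq_zero fun b _ => ?_
  rw [← AddMonoidHom.finsetSum_apply, ← map_sum]
  have : ∑ t, act (s (v t) b) (x t) = 0 := by
    funext E
    refine CharacterModule.ext X fun y => ?_
    have h' := h E ((Finsupp.lapply b ∘ₗ s).smulRight y)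
    rw [Finset.sum_apply]
    refine (AddMonoidHom.finsetSum_apply (M := X) (N := AddCircle (1 : ℚ)) _ _ y).trans ?_
    exact h'
  rw [this, map_zero, AddMonoidHom.zero_apply]

end Characters

/-! ### Rings of finite weak global dimension -/

section FiniteWeakGlobalDimension

variable {k : Type u} [CommRing k] {V : ℤ → Type*} [∀ n, AddCommGroup (V n)]
  [∀ n, Module k (V n)]

/-- An acyclic complex of flat modules stays acyclic after tensoring with a module of finite flat
dimension, by dimension shifting. -/
theorem lTensor_exact_of_flatDimensionLE [∀ n, Module.Flat k (V n)]
    (d : ∀ i j, V i →ₗ[k] V j)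
    (hex : ∀ i j l, i = j + 1 → j = l + 1 → Function.Exact (d i j) (d j l)) (n : ℕ) :
    ∀ (I : Type u) [AddCommGroup I] [Module k I], FlatDimensionLE k n I → ∀ i j l,
      i = j + 1 → j = l + 1 →
        Function.Exact ((d i j).lTensor I) ((d j l).lTensor I) := by
  induction n with
  | zero =>
    intro I _ _ hI i j l hij hjl
    have : Module.Flat k I := hI
    exact Module.Flat.lTensor_exact I (hex i j l hij hjl)
  | succ n ih =>
    intro I _ _ hI i j l hij hjl
    obtain ⟨F, _, _, f, hF, hf, hker⟩ := hI
    have comm : ∀ {A B : Type u} [AddCommGroup A] [Module k A] [AddCommGroup B] [Module k B]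
        (φ : A →ₗ[k] B) (a b : ℤ) (x : A ⊗[k] V a),
        φ.rTensor _ ((d a b).lTensor A x) = (d a b).lTensor B (φ.rTensor _ x) := by
      intro A B _ _ _ _ φ a b x
      rw [← LinearMap.comp_apply, ← LinearMap.comp_apply, LinearMap.rTensor_comp_lTensor,
        LinearMap.lTensor_comp_rTensor]
    have hdd : ∀ {A : Type u} [AddCommGroup A] [Module k A] (a b c : ℤ), a = b + 1 → b = c + 1 →
        ∀ x : A ⊗[k] V a, (d b c).lTensor A ((d a b).lTensor A x) = 0 := by
      intro A _ _ a b c hab hbc x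
      rw [← LinearMap.lTensor_comp_apply, (hex a b c hab hbc).linearMap_comp_eq_zero,
        LinearMap.lTensor_zero, LinearMap.zero_apply]
    refine fun x => ⟨fun hx => ?_, ?_⟩
    · obtain ⟨x, rfl⟩ := LinearMap.rTensor_surjective (V j) hf x
      rw [← comm] at hx
      obtain ⟨y, hy⟩ := (rTensor_exact (V l) f.exact_subtype_ker_map hf _).1 hx
      have hy0 : (d l (l - 1)).lTensor _ y = 0 := by
        refine Module.Flat.rTensor_preserves_injective_linearMap _
          (LinearMap.ker f).injective_subtype ?_
        rw [comm, hy, hdd j l (l - 1) hjl (by ring), map_zero]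
      obtain ⟨z, rfl⟩ := (ih _ hker j l (l - 1) hjl (by ring) y).1 hy0
      rw [comm] at hy
      obtain ⟨w, hw⟩ := (Module.Flat.lTensor_exact F (hex i j l hij hjl)
        (x - (LinearMap.ker f).subtype.rTensor _ z)).1 (by rw [map_sub, hy, sub_self])
      refine ⟨f.rTensor _ w, ?_⟩
      rw [← comm, hw, map_sub, ← LinearMap.rTensor_comp_apply, LinearMap.comp_ker_subtype,
        LinearMap.rTensor_zero, LinearMap.zero_apply, sub_zero]
    · rintro ⟨y, rfl⟩
      exact hdd i j l hij hjl y

/-- Over a commutative ring of finite weak global dimension, every acyclic complex of projective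
modules is locally `Hom(-, X)`-acyclic for all `X`. -/
theorem HasFiniteWeakGlobalDimension.exists_local (hk : HasFiniteWeakGlobalDimension k)
    [∀ n, Module.Projective k (V n)] (d : ∀ i j, V i →ₗ[k] V j)
    (hex : ∀ i j l, i = j + 1 → j = l + 1 → Function.Exact (d i j) (d j l))
    {X : Type*} [AddCommGroup X] [Module k X] (n : ℤ) (T : Finset (V n)) :
    ∃ E : Finset (V (n + 1)), ∀ f : V n →ₗ[k] X, (∀ x ∈ E, f (d (n + 1) n x) = 0) →
      ∃ g : V (n - 1) →ₗ[k] X, ∀ x ∈ T, g (d n (n - 1) x) = f x := by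
  classical
  obtain ⟨m, hm⟩ := hk
  refine exists_local_of_characters _ _ T fun χ hχ => ?_
  let I := Finset (V (n + 1)) → CharacterModule X
  let β : I →+ V (n - 1) →+ I ⊗[k] V (n - 1) :=
    { toFun x := (TensorProduct.mk k I (V (n - 1)) x).toAddMonoidHom
      map_zero' := by ext; simp
      map_add' _ _ := by ext; simp }
  have hcycle : ∑ t, χ t ⊗ₜ[k] d n (n - 1) t = (0 : I ⊗[k] V (n - 1)) :=
    sum_balanced_eq_zero β (fun r x x' v hx => by
      have : x' = r • x := funext fun E => CharacterModule.ext X fun y => hx E y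
      rw [this]
      exact (TensorProduct.smul_tmul r x v).symm) χ (fun t => d n (n - 1) t) hχ
  -- The submodule of `I` spanned by `χ` is a quotient `A` of `k ^ T`, hence lives in the universe
  -- in which flat dimensions are bounded.
  let e := Fintype.equivFin T
  let φ : (Fin (Fintype.card T) → k) →ₗ[k] I :=
    Fintype.linearCombination k fun i => χ (e.symm i)
  let ι := (LinearMap.ker φ).liftQ φ le_rfl
  have hι : Function.Injective ι := LinearMap.ker_eq_bot.1 (Submodule.ker_liftQ_eq_bot _ _ _ le_rfl)
  let ξ : ((Fin (Fintype.card T) → k) ⧸ LinearMap.ker φ) ⊗[k] V n :=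
    ∑ t : T, (LinearMap.ker φ).mkQ (Pi.single (e t) 1) ⊗ₜ[k] (t : V n)
  have hι_mk : ∀ t, ι ((LinearMap.ker φ).mkQ (Pi.single (e t) 1)) = χ t := by
    intro t
    simp [ι, φ]
  have hξ : ι.rTensor _ ξ = ∑ t, χ t ⊗ₜ[k] (t : V n) := by
    simp [ξ, hι_mk, -Submodule.mkQ_apply]
  have hdξ : (d n (n - 1)).lTensor _ ξ = 0 := by
    refine Module.Flat.rTensor_preserves_injective_linearMap ι hι ?_
    rw [← LinearMap.comp_apply, LinearMap.rTensor_comp_lTensor, ← LinearMap.lTensor_comp_rTensor,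
      LinearMap.comp_apply, hξ, map_zero, ← hcycle]
    simp
  obtain ⟨η, hη⟩ := (lTensor_exact_of_flatDimensionLE d hex m _ (hm _) (n + 1) n (n - 1) rfl
    (by ring) ξ).1 hdξ
  let pairing : Finset (V (n + 1)) → (V n →ₗ[k] X) → I ⊗[k] V n →+ AddCircle (1 : ℚ) :=
    fun E f => TensorProduct.liftAddHom
      { toFun x := AddMonoidHom.comp (x E) f.toAddMonoidHom
        map_zero' := rfl
        map_add' _ _ := rfl } fun r x v => by
          change x E (r • f v) = x E (f (r • v))
          rw [map_smul f]
  have hpairing : ∀ η : I ⊗[k] V (n + 1), ∃ J : Finset (V (n + 1)),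
      ∀ (E : Finset (V (n + 1))) (f : V n →ₗ[k] X), (∀ x ∈ J, f (d (n + 1) n x) = 0) →
        pairing E f ((d (n + 1) n).lTensor I η) = 0 := by
    intro η
    induction η with
    | zero => exact ⟨∅, fun E f _ => by simp⟩
    | tmul x v =>
      refine ⟨{v}, fun E f hf => ?_⟩
      change x E (f (d (n + 1) n v)) = 0
      rw [hf v (Finset.mem_singleton_self v), map_zero]
    | add a b ha hb =>
      obtain ⟨J, hJ⟩ := ha
      obtain ⟨J', hJ'⟩ := hb
      refine ⟨J ∪ J', fun E f hf => ?_⟩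
      rw [map_add, map_add, hJ E f fun x hx => hf x (Finset.mem_union_left _ hx),
        hJ' E f fun x hx => hf x (Finset.mem_union_right _ hx), add_zero]
  obtain ⟨J, hJ⟩ := hpairing (ι.rTensor _ η)
  refine ⟨J, fun E f hf => ?_⟩
  rw [← hJ E f hf, ← LinearMap.comp_apply, LinearMap.lTensor_comp_rTensor,
    ← LinearMap.rTensor_comp_lTensor, LinearMap.comp_apply, hη, hξ, map_sum]
  rfl

/-- Over a commutative ring of finite weak global dimension, the cokernels of the differentials of
an acyclic complex of projective modules are projective. -/
theorem HasFiniteWeakGlobalDimension.projective_of_acyclic (hk : HasFiniteWeakGlobalDimension k)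
    [∀ n, Module.Projective k (V n)] (d : ∀ i j, V i →ₗ[k] V j)
    (hex : ∀ i j l, i = j + 1 → j = l + 1 → Function.Exact (d i j) (d j l))
    (hd : ∀ i j l x, d j l (d i j x) = 0)
    {X : Type*} [AddCommGroup X] [Module k X] (n : ℤ) (π : V n →ₗ[k] X)
    (hπ : Function.Surjective π) (hπd : Function.Exact (d (n + 1) n) π) :
    Module.Projective k X := by
  obtain ⟨g, hg⟩ := exists_coboundary_of_local_of_complex d hd (hk.exists_local d hex) n π
    fun x => (hπd _).2 ⟨x, rfl⟩
  -- `d` factors through `π` as an injection of `X`, which `g` splits.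
  obtain ⟨j, hj⟩ : ∃ j : X →ₗ[k] V (n - 1), j ∘ₗ π = d n (n - 1) := by
    refine ⟨(LinearMap.ker π).liftQ (d n (n - 1)) ?_ ∘ₗ
      (π.quotKerEquivOfSurjective hπ).symm.toLinearMap, ?_⟩
    · intro x hx
      obtain ⟨y, rfl⟩ := (hπd x).1 hx
      exact hd _ _ _ y
    · ext x
      have : (π.quotKerEquivOfSurjective hπ).symm (π x) = Submodule.Quotient.mk x :=
        (LinearEquiv.symm_apply_eq _).2 rfl
      simp [this]
  refine Module.Projective.of_split j g (LinearMap.ext fun x => ?_)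
  obtain ⟨x, rfl⟩ := hπ x
  rw [LinearMap.comp_apply, ← LinearMap.comp_apply j, hj, hg, LinearMap.id_apply]

end FiniteWeakGlobalDimension

/-! ### Character modules as injective right modules -/

section RightCharacters

variable {R : Type u} [Ring R]

/-- The right module structure on the characters of a left module `X`: `(χ r)(x) = χ(r x)`. -/
instance CharacterModule.rightModule {X : Type*} [AddCommGroup X] [Module R X] :
    Module Rᵐᵒᵖ (CharacterModule X) where
  smul r χ := AddMonoidHom.comp χ (DistribSMul.toAddMonoidHom X r.unop)
  one_smul χ := CharacterModule.ext X fun x => congrArg χ (one_smul R x)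
  mul_smul r s χ := CharacterModule.ext X fun x => congrArg χ (mul_smul s.unop r.unop x)
  smul_zero _ := rfl
  smul_add _ _ _ := rfl
  add_smul r s χ := CharacterModule.ext X fun x =>
    (congrArg χ (add_smul r.unop s.unop x)).trans (map_add χ _ _)
  zero_smul χ := CharacterModule.ext X fun x => (congrArg χ (zero_smul R x)).trans (map_zero χ)

theorem CharacterModule.op_smul_apply {X : Type*} [AddCommGroup X] [Module R X] (r : R)
    (χ : CharacterModule X) (x : X) : (MulOpposite.op r • χ) x = χ (r • x) := rfl

/-- Products of copies of the character module of a free left module are injective right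
modules: maps into them are families of characters of the source. -/
theorem CharacterModule.injective_pi_finsupp (Λ κ : Type u) :
    Module.Injective Rᵐᵒᵖ (Λ → CharacterModule (κ →₀ R)) := by
  refine ⟨fun A B _ _ _ _ f hf φ => ?_⟩
  let φ' : Λ → κ → CharacterModule A := fun l i =>
    { toFun a := φ a l (Finsupp.single i 1)
      map_zero' := by rw [map_zero]; rfl
      map_add' a b := by rw [map_add]; rfl }
  choose ψ hψ using fun l i => CharacterModule.dual_surjective_of_injective
    f.toAddMonoidHom.toIntLinearMap hf (φ' l i)
  have hψ' : ∀ l i a, ψ l i (f a) = φ a l (Finsupp.single i 1) := fun l i a =>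
    DFunLike.congr_fun (hψ l i) a
  let act : Λ → κ → B → R →+ AddCircle (1 : ℚ) := fun l i b =>
    { toFun r := ψ l i (MulOpposite.op r • b)
      map_zero' := by rw [MulOpposite.op_zero, zero_smul, map_zero]
      map_add' r s := by rw [MulOpposite.op_add, add_smul, map_add] }
  let h : B → Λ → CharacterModule (κ →₀ R) := fun b l => Finsupp.liftAddHom fun i => act l i b
  have hh : ∀ b l i r, h b l (Finsupp.single i r) = ψ l i (MulOpposite.op r • b) := by
    intro b l i r
    exact Finsupp.liftAddHom_apply_single (fun i => act l i b) i r
  have hext : ∀ c c' : Λ → CharacterModule (κ →₀ R),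
      (∀ l i r, c l (Finsupp.single i r) = c' l (Finsupp.single i r)) → c = c' := fun c c' hc =>
    funext fun l => Finsupp.addHom_ext (f := c l) (g := c' l) (hc l)
  refine ⟨{ toFun := h, map_add' := fun b b' => ?_, map_smul' := fun s b => ?_ }, fun a => ?_⟩
  · refine hext _ _ fun l i r => ?_
    change _ = h b l _ + h b' l _
    rw [hh, hh, hh, smul_add, map_add]
  · refine hext _ _ fun l i r => ?_
    change _ = h b l (s.unop • _)
    rw [hh, Finsupp.smul_single, hh, smul_smul]
    rfl
  · refine hext _ _ fun l i r => ?_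
    change h (f a) l _ = _
    rw [hh, ← map_smul f, hψ', map_smul]
    change φ a l (r • _) = _
    rw [Finsupp.smul_single, smul_eq_mul, mul_one]

end RightCharacters

/-! ### Acyclicity of tensor products implies total acyclicity -/

section TotallyAcyclic

variable {R : Type u} [Ring R]

theorem ChainComplex.acyclic_iff_function_exact (K : ChainComplex (ModuleCat.{u} R) ℤ) :
    K.Acyclic ↔ ∀ i j l, i = j + 1 → j = l + 1 → Function.Exact (K.d i j).hom (K.d j l).hom := by
  constructor
  · rintro h i j l rfl rfl
    have := h (l + 1)
    rw [HomologicalComplex.exactAt_iff' K (l + 1 + 1) (l + 1) l (by simp) (by simp),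
      ShortComplex.ShortExact.moduleCat_exact_iff_function_exact] at this
    exact this
  · intro h n
    rw [HomologicalComplex.exactAt_iff' K (n + 1) n (n - 1) (by simp) (by simp),
      ShortComplex.ShortExact.moduleCat_exact_iff_function_exact]
    exact h _ _ _ rfl (by ring)

variable {K : ChainComplex (ModuleCat.{u} R) ℤ}

/-- The pairing of `I ⊗_R V` with a map `f : V → X` and a linear map from `I` to the characters of
`X`. -/
def balancedPairing {I V X : Type u} [AddCommGroup I] [Module Rᵐᵒᵖ I] [AddCommGroup V] [Module R V]
    [AddCommGroup X] [Module R X] (ev : I →ₗ[Rᵐᵒᵖ] CharacterModule X) (f : V →ₗ[R] X) :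
    BalancedTensor R I V →+ AddCircle (1 : ℚ) :=
  QuotientAddGroup.lift _ (TensorProduct.liftAddHom
      { toFun x := AddMonoidHom.comp (ev x) f.toAddMonoidHom
        map_zero' := by rw [map_zero]; rfl
        map_add' x y := by rw [map_add]; rfl }
      fun r x v => by
        change ev (r • x) (f v) = ev x (f (r • v))
        rw [map_zsmul, map_zsmul, map_zsmul]
        rfl) <| by
    refine (AddSubgroup.closure_le _).2 ?_
    rintro _ ⟨x, r, v, rfl⟩
    change _ = _
    rw [map_sub, sub_eq_zero]
    change ev (MulOpposite.op r • x) (f v) = ev x (f (r • v))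
    rw [map_smul ev, map_smul f, CharacterModule.op_smul_apply]

theorem balancedPairing_tmul {I V X : Type u} [AddCommGroup I] [Module Rᵐᵒᵖ I] [AddCommGroup V]
    [Module R V] [AddCommGroup X] [Module R X] (ev : I →ₗ[Rᵐᵒᵖ] CharacterModule X) (f : V →ₗ[R] X)
    (x : I) (v : V) :
    balancedPairing ev f (QuotientAddGroup.mk (x ⊗ₜ[ℤ] v)) = ev x (f v) := rfl

theorem BalancedTensor.exact_of_acyclic {I : Type u} [AddCommGroup I] [Module Rᵐᵒᵖ I]
    (h : (((balancedTensorFunctor R I).mapHomologicalComplex _).obj K).Acyclic) (n : ℤ)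
    (ξ : BalancedTensor R I (K.X n)) (hξ : balancedTensorMap R I (K.d n (n - 1)).hom ξ = 0) :
    ∃ η, balancedTensorMap R I (K.d (n + 1) n).hom η = ξ := by
  have := h n
  rw [HomologicalComplex.exactAt_iff' _ (n + 1) n (n - 1) (by simp) (by simp),
    ShortComplex.ab_exact_iff] at this
  exact this ξ hξ

/-- If an acyclic complex of projective modules stays acyclic after tensoring with injective right
modules, it is locally acyclic with respect to maps into free modules. -/
theorem IsAcyclicProjectiveComplex.exists_local (hK : IsAcyclicProjectiveComplex K)
    (hI : ∀ (I : Type u) [AddCommGroup I] [Module Rᵐᵒᵖ I], Module.Injective Rᵐᵒᵖ I →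
      (((balancedTensorFunctor R I).mapHomologicalComplex _).obj K).Acyclic)
    (κ : Type u) (n : ℤ) (T : Finset (K.X n)) :
    ∃ E : Finset (K.X (n + 1)), ∀ f : K.X n →ₗ[R] (κ →₀ R),
      (∀ x ∈ E, f ((K.d (n + 1) n).hom x) = 0) →
        ∃ g : K.X (n - 1) →ₗ[R] (κ →₀ R), ∀ x ∈ T, g ((K.d n (n - 1)).hom x) = f x := by
  classical
  have := hK.projective
  refine exists_local_of_characters _ _ T fun χ hχ => ?_
  let I := Finset (K.X (n + 1)) → CharacterModule (κ →₀ R)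
  let β : I →+ K.X (n - 1) →+ BalancedTensor R I (K.X (n - 1)) :=
    { toFun x := (QuotientAddGroup.mk' _).comp
        (TensorProduct.mk ℤ I (K.X (n - 1)) x).toAddMonoidHom
      map_zero' := by ext; simp
      map_add' _ _ := by ext; simp }
  have hcycle : ∑ t, β (χ t) ((K.d n (n - 1)).hom t) = 0 :=
    sum_balanced_eq_zero β (fun r x x' v hx => by
      have : x' = MulOpposite.op r • x :=
        funext fun E => CharacterModule.ext _ fun y => hx E y
      rw [this]
      refine (QuotientAddGroup.eq_iff_sub_mem.2 ?_).symm
      exact AddSubgroup.subset_closure ⟨x, r, v, rfl⟩) χ (fun t => (K.d n (n - 1)).hom t) hχ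
  let ξ : BalancedTensor R I (K.X n) :=
    ∑ t, QuotientAddGroup.mk (χ t ⊗ₜ[ℤ] (t : K.X n))
  obtain ⟨η, hη⟩ := BalancedTensor.exact_of_acyclic
    (hI I (CharacterModule.injective_pi_finsupp _ κ)) n ξ (by
      rw [map_sum, ← hcycle]
      rfl)
  let pairing := fun (E : Finset (K.X (n + 1))) (f : K.X n →ₗ[R] (κ →₀ R)) =>
    balancedPairing (I := I) (LinearMap.proj (R := Rᵐᵒᵖ) E) f
  have hpairing : ∀ η : I ⊗[ℤ] K.X (n + 1), ∃ J : Finset (K.X (n + 1)),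
      ∀ (E : Finset (K.X (n + 1))) (f : K.X n →ₗ[R] (κ →₀ R)),
        (∀ x ∈ J, f ((K.d (n + 1) n).hom x) = 0) →
          pairing E f (balancedTensorMap R I (K.d (n + 1) n).hom (QuotientAddGroup.mk η)) = 0 := by
    intro η
    induction η with
    | zero => exact ⟨∅, fun E f _ => by simp⟩
    | tmul x v =>
      refine ⟨{v}, fun E f hf => ?_⟩
      rw [balancedTensorMap_tmul, balancedPairing_tmul, hf v (Finset.mem_singleton_self v),
        map_zero]
    | add a b ha hb =>
      obtain ⟨J, hJ⟩ := ha
      obtain ⟨J', hJ'⟩ := hb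
      refine ⟨J ∪ J', fun E f hf => ?_⟩
      rw [QuotientAddGroup.mk_add, map_add, map_add,
        hJ E f fun x hx => hf x (Finset.mem_union_left _ hx),
        hJ' E f fun x hx => hf x (Finset.mem_union_right _ hx), add_zero]
  obtain ⟨η, rfl⟩ := QuotientAddGroup.mk_surjective η
  obtain ⟨J, hJ⟩ := hpairing η
  refine ⟨J, fun E f hf => ?_⟩
  rw [← hJ E f hf, hη, map_sum]
  rfl

/-- An acyclic complex of projective modules that stays acyclic after tensoring with injective
right modules is totally acyclic. -/
theorem IsAcyclicProjectiveComplex.isTotallyAcyclic (hK : IsAcyclicProjectiveComplex K)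
    (hI : ∀ (I : Type u) [AddCommGroup I] [Module Rᵐᵒᵖ I], Module.Injective Rᵐᵒᵖ I →
      (((balancedTensorFunctor R I).mapHomologicalComplex _).obj K).Acyclic) :
    IsTotallyAcyclicProjectiveComplex K := by
  refine ⟨hK, fun Q hQ n => ?_⟩
  have := hK.projective
  obtain ⟨s, hs⟩ := Module.projective_def'.1 hQ
  rw [HomologicalComplex.exactAt_iff' _ (n - 1) n (n + 1)
    (ComplexShape.prev_eq' _ (sub_add_cancel n 1)) (ComplexShape.next_eq' _ rfl),
    ShortComplex.ab_exact_iff]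
  intro (f : K.X n ⟶ Q) (hf : K.d (n + 1) n ≫ f = 0)
  obtain ⟨g, hg⟩ := exists_coboundary_of_local_of_complex (fun i j => (K.d i j).hom)
    (fun i j l x => LinearMap.congr_fun (congrArg ModuleCat.Hom.hom (K.d_comp_d i j l)) x)
    (hK.exists_local hI Q) n (s ∘ₗ f.hom) fun x =>
      (congrArg s (LinearMap.congr_fun (congrArg ModuleCat.Hom.hom hf) x)).trans (map_zero s)
  refine ⟨(ModuleCat.ofHom (Finsupp.linearCombination R id ∘ₗ g) : K.X (n - 1) ⟶ Q), ?_⟩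
  change K.d n (n - 1) ≫ ModuleCat.ofHom (Finsupp.linearCombination R id ∘ₗ g) = f
  ext x
  exact congr(Finsupp.linearCombination R id $(hg x)).trans (LinearMap.congr_fun hs _)

end TotallyAcyclic

/-! ### Tensor products with diagonal action -/

section DiagonalTensor

variable {k : Type u} [CommRing k] {G : Type v} [Group G]

theorem Representation.ofModule'_apply {V : Type*} [AddCommGroup V] [Module k V] [Module k[G] V]
    [IsScalarTower k k[G] V] (g : G) (x : V) :
    Representation.ofModule' (k := k) (G := G) V g x = MonoidAlgebra.single g (1 : k) • x := rfl

theorem Representation.single_one_smul {V : Type*} [AddCommMonoid V] [Module k V]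
    (ρ : Representation k G V) (g : G) (x : ρ.asModule) :
    MonoidAlgebra.single g (1 : k) • x = ρ.asModuleEquiv.symm (ρ g (ρ.asModuleEquiv x)) := by
  rw [Representation.single_smul, one_smul]
  rfl

/-- A projective module over a group algebra is projective over the ground ring. -/
theorem MonoidAlgebra.projective_restrict (V : Type*) [AddCommGroup V] [Module k V]
    [Module k[G] V] [IsScalarTower k k[G] V] [Module.Projective k[G] V] :
    Module.Projective k V := by
  obtain ⟨s, hs⟩ := Module.projective_def'.1 (inferInstance : Module.Projective k[G] V)
  have : Module.Free k k[G] := .of_equiv (MonoidAlgebra.coeffLinearEquiv k).symm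
  exact Module.Projective.of_split (s.restrictScalars k)
    ((Finsupp.linearCombination k[G] id).restrictScalars k)
    (LinearMap.ext fun x => LinearMap.congr_fun hs x)

variable {N : Type*} [AddCommGroup N] [Module k N] (σ : Representation k G N)
  {V : Type*} [AddCommGroup V] [Module k V] [Module k[G] V] [IsScalarTower k k[G] V]

/-- The tensor product of a `k[G]`-module `V` with a representation, with diagonal action. -/
abbrev DiagonalTensor (V : Type*) [AddCommGroup V] [Module k V] [Module k[G] V]
    [IsScalarTower k k[G] V] : Type _ :=
  ((Representation.ofModule' (k := k) (G := G) V).tprod σ).asModule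

/-- An equivariant map `V → W` induces a `k[G]`-linear map on diagonal tensor products. -/
def diagonalTensorMap {W : Type*} [AddCommGroup W] [Module k W] (τ : Representation k G W)
    (f : V →ₗ[k] W) (hf : ∀ g x, f (MonoidAlgebra.single g (1 : k) • x) = τ g (f x)) :
    DiagonalTensor σ V →ₗ[k[G]] (τ.tprod σ).asModule :=
  MonoidAlgebra.equivariantOfLinearOfComm
    ((τ.tprod σ).asModuleEquiv.symm.toLinearMap ∘ₗ f.rTensor N ∘ₗ
      ((Representation.ofModule' (k := k) (G := G) V).tprod σ).asModuleEquiv.toLinearMap) <| by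
    intro g x
    rw [Representation.single_one_smul, Representation.single_one_smul]
    simp only [LinearMap.comp_apply, LinearEquiv.coe_coe, LinearEquiv.apply_symm_apply,
      Representation.tprod_apply]
    congr 1
    rw [← LinearMap.comp_apply, ← LinearMap.comp_apply]
    congr 1
    ext v n
    simp [hf, Representation.ofModule'_apply]

/-- Equivariant pairings `V × N → B` lift along surjections `A → B` if `V` is projective over `k[G]`
and `N` is projective over `k`: such pairings are the `k[G]`-linear maps `V → Hom_k(N, B)`. -/
theorem exists_equivariant_pairing_lift [Module.Projective k[G] V] [Module.Projective k N]
    {A B : Type*} [AddCommGroup A] [Module k A] [Module k[G] A] [IsScalarTower k k[G] A]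
    [AddCommGroup B] [Module k B] [Module k[G] B] [IsScalarTower k k[G] B]
    (f : A →ₗ[k[G]] B) (hf : Function.Surjective f) (ψ : V →ₗ[k] N →ₗ[k] B)
    (hψ : ∀ g x n, ψ (MonoidAlgebra.single g (1 : k) • x) (σ g n) =
      MonoidAlgebra.single g (1 : k) • ψ x n) :
    ∃ φ : V →ₗ[k] N →ₗ[k] A, (∀ g x n, φ (MonoidAlgebra.single g (1 : k) • x) (σ g n) =
      MonoidAlgebra.single g (1 : k) • φ x n) ∧ ∀ x n, f (φ x n) = ψ x n := by
  let α : Representation k G A := Representation.ofModule' A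
  let β : Representation k G B := Representation.ofModule' B
  let Φ : (σ.linHom α).asModule →ₗ[k[G]] (σ.linHom β).asModule :=
    MonoidAlgebra.equivariantOfLinearOfComm
      ((σ.linHom β).asModuleEquiv.symm.toLinearMap ∘ₗ
        LinearMap.compRight k (f.restrictScalars k) ∘ₗ (σ.linHom α).asModuleEquiv.toLinearMap) <| by
      intro g φ
      rw [Representation.single_one_smul, Representation.single_one_smul]
      simp only [LinearMap.comp_apply, LinearEquiv.coe_coe, LinearEquiv.apply_symm_apply]
      congr 1
      ext n
      simp [Representation.ofModule'_apply, α, β]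
  have hΦ : Function.Surjective Φ := fun ψ => by
    obtain ⟨φ, hφ⟩ := Module.projective_lifting_property (f.restrictScalars k)
      ((σ.linHom β).asModuleEquiv ψ) hf
    exact ⟨(σ.linHom α).asModuleEquiv.symm φ, hφ⟩
  let ψ' : V →ₗ[k[G]] (σ.linHom β).asModule :=
    MonoidAlgebra.equivariantOfLinearOfComm
      ((σ.linHom β).asModuleEquiv.symm.toLinearMap ∘ₗ ψ) <| by
      intro g x
      rw [Representation.single_one_smul]
      simp only [LinearMap.comp_apply, LinearEquiv.coe_coe, LinearEquiv.apply_symm_apply]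
      congr 1
      ext n
      simp [Representation.ofModule'_apply, β, ← hψ]
  obtain ⟨h, hh⟩ := Module.projective_lifting_property Φ ψ' hΦ
  refine ⟨(σ.linHom α).asModuleEquiv.toLinearMap ∘ₗ h.restrictScalars k, fun g x n => ?_,
    fun x n => congr((σ.linHom β).asModuleEquiv ($hh x) n)⟩
  simp only [LinearMap.comp_apply, LinearEquiv.coe_coe, LinearMap.restrictScalars_apply]
  rw [map_smul, Representation.single_one_smul]
  simp [Representation.ofModule'_apply, α]

/-- If `V` is projective over `k[G]` and `N` is projective over `k`, then `V ⊗ N` with the diagonal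
action is projective over `k[G]`. -/
theorem projective_diagonalTensor [Module.Projective k[G] V] [Module.Projective k N] :
    Module.Projective k[G] (DiagonalTensor σ V) := by
  let τ := (Representation.ofModule' (k := k) (G := G) V).tprod σ
  refine Module.Projective.of_lifting_property'' fun f hf => ?_
  have hτ : ∀ g x n, (MonoidAlgebra.single g (1 : k) • τ.asModuleEquiv.symm (x ⊗ₜ[k] n)) =
      τ.asModuleEquiv.symm ((MonoidAlgebra.single g (1 : k) • x) ⊗ₜ[k] σ g n) := by
    intro g x n
    rw [Representation.single_one_smul, LinearEquiv.apply_symm_apply]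
    simp [τ, Representation.ofModule'_apply]
  obtain ⟨φ, hφ, hfφ⟩ := exists_equivariant_pairing_lift σ f hf
    ((TensorProduct.mk k V N).compr₂ τ.asModuleEquiv.symm.toLinearMap) fun g x n => (hτ g x n).symm
  refine ⟨MonoidAlgebra.equivariantOfLinearOfComm
    (TensorProduct.lift φ ∘ₗ τ.asModuleEquiv.toLinearMap) fun g x => ?_, ?_⟩
  · obtain ⟨x, rfl⟩ := τ.asModuleEquiv.symm.surjective x
    induction x with
    | zero => simp
    | tmul x n =>
      rw [hτ]
      simp [hφ]
    | add x y hx hy => rw [map_add, smul_add, map_add, hx, hy, map_add, smul_add]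
  · refine LinearMap.ext fun x => ?_
    obtain ⟨x, rfl⟩ := τ.asModuleEquiv.symm.surjective x
    induction x with
    | zero => simp
    | tmul x n => exact hfφ x n
    | add x y hx hy => rw [map_add, map_add, hx, hy, map_add]

end DiagonalTensor

/-! ### The complex `K ⊗ N` -/

section TensorComplex

variable {k : Type u} [CommRing k] {G : Type v} [Group G]

/-- A `k[G]`-module is a `k`-module by restriction of scalars. -/
local instance ModuleCat.moduleBase (V : ModuleCat.{max u v} k[G]) : Module k V :=
  Module.compHom V (algebraMap k k[G])

local instance ModuleCat.isScalarTowerBase (V : ModuleCat.{max u v} k[G]) :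
    IsScalarTower k k[G] V :=
  IsScalarTower.of_algebraMap_smul fun _ _ => rfl

variable {N : Type (max u v)} [AddCommGroup N] [Module k N] (σ : Representation k G N)

/-- The complex `K ⊗ N` with diagonal action. -/
def diagonalTensorComplex (K : ChainComplex (ModuleCat.{max u v} k[G]) ℤ) :
    ChainComplex (ModuleCat.{max u v} k[G]) ℤ where
  X n := ModuleCat.of k[G] (DiagonalTensor σ (K.X n))
  d i j := ModuleCat.ofHom (diagonalTensorMap σ (Representation.ofModule' (K.X j))
    ((K.d i j).hom.restrictScalars k) fun g x => map_smul (K.d i j).hom _ x)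
  shape i j hij := by
    have h : (K.d i j).hom.restrictScalars k = 0 :=
      LinearMap.ext fun y => LinearMap.congr_fun (congrArg ModuleCat.Hom.hom (K.shape i j hij)) y
    refine ModuleCat.hom_ext (LinearMap.ext fun (x : K.X i ⊗[k] N) => ?_)
    change ((K.d i j).hom.restrictScalars k).rTensor N x = (0 : K.X j ⊗[k] N)
    rw [h, LinearMap.rTensor_zero, LinearMap.zero_apply]
  d_comp_d' i j l _ _ := by
    have h : (K.d j l).hom.restrictScalars k ∘ₗ (K.d i j).hom.restrictScalars k = 0 :=
      LinearMap.ext fun y => LinearMap.congr_fun (congrArg ModuleCat.Hom.hom (K.d_comp_d i j l)) y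
    refine ModuleCat.hom_ext (LinearMap.ext fun (x : K.X i ⊗[k] N) => ?_)
    change ((K.d j l).hom.restrictScalars k).rTensor N
      (((K.d i j).hom.restrictScalars k).rTensor N x) = (0 : K.X l ⊗[k] N)
    rw [← LinearMap.rTensor_comp_apply, h, LinearMap.rTensor_zero, LinearMap.zero_apply]

theorem IsAcyclicProjectiveComplex.diagonalTensorComplex [Module.Projective k N]
    {K : ChainComplex (ModuleCat.{max u v} k[G]) ℤ} (hK : IsAcyclicProjectiveComplex K) :
    IsAcyclicProjectiveComplex (diagonalTensorComplex σ K) where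
  projective n :=
    have := hK.projective n
    projective_diagonalTensor σ
  acyclic := by
    rw [ChainComplex.acyclic_iff_function_exact]
    intro i j l hij hjl
    exact Module.Flat.rTensor_exact (R := k) N (f := (K.d i j).hom.restrictScalars k)
      (g := (K.d j l).hom.restrictScalars k)
      ((ChainComplex.acyclic_iff_function_exact K).1 hK.acyclic i j l hij hjl)

theorem exists_surjective_exact_of_quotient_range_equiv {R A B C : Type*} [Ring R] [AddCommGroup A]
    [Module R A] [AddCommGroup B] [Module R B] [AddCommGroup C] [Module R C] {f : A →ₗ[R] B}
    (e : (B ⧸ LinearMap.range f) ≃ₗ[R] C) :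
    ∃ π : B →ₗ[R] C, Function.Surjective π ∧ Function.Exact f π := by
  refine ⟨e.toLinearMap ∘ₗ (LinearMap.range f).mkQ,
    e.surjective.comp (Submodule.mkQ_surjective _), fun x => ?_⟩
  simp

/-- Over a ring of finite weak global dimension, Gorenstein projective `k[G]`-modules are projective
over `k`. -/
theorem IsGorensteinProjective.projective_base (hk : HasFiniteWeakGlobalDimension k)
    (hN : IsGorensteinProjective k[G] σ.asModule) : Module.Projective k N := by
  obtain ⟨K, hK, n, ⟨e⟩⟩ := hN
  obtain ⟨π, hπ, hπd⟩ := exists_surjective_exact_of_quotient_range_equiv e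
  have (n : ℤ) : Module.Projective k (K.X n) :=
    have := hK.projective n
    MonoidAlgebra.projective_restrict (G := G) (K.X n)
  have := hk.projective_of_acyclic (fun i j => (K.d i j).hom.restrictScalars k)
    (fun i j l hij hjl => (ChainComplex.acyclic_iff_function_exact K).1 hK.acyclic i j l hij hjl)
    (fun i j l x => LinearMap.congr_fun (congrArg ModuleCat.Hom.hom (K.d_comp_d i j l)) x) n
    (π.restrictScalars k) hπ hπd
  exact Module.Projective.of_equiv' σ.asModuleEquiv

theorem nonempty_coker_diagonalTensorComplex_equiv (K : ChainComplex (ModuleCat.{max u v} k[G]) ℤ)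
    {M : Type (max u v)} [AddCommGroup M] [Module k M] (ρ : Representation k G M) (n : ℤ)
    (e : (K.X n ⧸ LinearMap.range (K.d (n + 1) n).hom) ≃ₗ[k[G]] ρ.asModule) :
    Nonempty (((diagonalTensorComplex σ K).X n ⧸
      LinearMap.range ((diagonalTensorComplex σ K).d (n + 1) n).hom) ≃ₗ[k[G]]
        (ρ.tprod σ).asModule) := by
  obtain ⟨π, hπ, hπd⟩ := exists_surjective_exact_of_quotient_range_equiv e
  let π' : K.X n →ₗ[k] M := ρ.asModuleEquiv.toLinearMap ∘ₗ π.restrictScalars k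
  let p : DiagonalTensor σ (K.X n) →ₗ[k[G]] (ρ.tprod σ).asModule :=
    diagonalTensorMap σ ρ π' fun g x => by
      simp only [π', LinearMap.comp_apply, LinearMap.restrictScalars_apply, map_smul π,
        Representation.single_one_smul, LinearEquiv.coe_coe, LinearEquiv.apply_symm_apply]
  have hp : Function.Surjective p := LinearMap.rTensor_surjective N (g := π') hπ
  have hex : Function.Exact ((diagonalTensorComplex σ K).d (n + 1) n).hom p :=
    rTensor_exact (R := k) N (f := (K.d (n + 1) n).hom.restrictScalars k) (g := π') hπd hπ
  exact ⟨(Submodule.quotEquivOfEq _ _ (LinearMap.exact_iff.1 hex).symm).trans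
    (p.quotKerEquivOfSurjective hp)⟩

end TensorComplex

end

theorem proposition2p1 (k : Type u) [CommRing k] (G : Type v) [Group G]
    (hk : HasFiniteWeakGlobalDimension k) (hG : IsXGroup k G)
    (M N : Type (max u v)) [AddCommGroup M] [Module k M] [AddCommGroup N] [Module k N]
    (ρ : Representation k G M) (σ : Representation k G N)
    (hM : IsGorensteinProjective k[G] ρ.asModule)
    (hN : IsGorensteinProjective k[G] σ.asModule) :
    IsGorensteinProjective k[G] (ρ.tprod σ).asModule := by
  have := hN.projective_base σ hk
  obtain ⟨K, hK, n, ⟨e⟩⟩ := hM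
  have hKN := hK.toIsAcyclicProjectiveComplex.diagonalTensorComplex σ
  exact ⟨_, hKN.isTotallyAcyclic (hG _ hKN), n,
    nonempty_coker_diagonalTensorComplex_equiv σ K ρ n e⟩
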